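/- **Conventions.** A real interval is a set $[a,b]$ with $a\le b$, and real intervals are combined by $J\odot K=\{u\odot v: u\in J,\ v\in K\}$ for $\odot\in\{+,-,\cdot\}$. A complex interval is $J=\Re(J)+i\,\Im(J)$ with $\Re(J),\Im(J)$ real intervals; complex intervals are added and subtracted componentwise and multiplied by $$J\cdot K=\big(\Re J\cdot\Re K-\Im J\cdot\Im K\big)+i\big(\Re J\cdot\Im K+\Im J\cdot\Re K\big).$$ A complex number $z$ is identified with the interval $[\Re z,\Re z]+i[\Im z,\Im z]$. An interval box in $\mathbb C^n$ is a vector $I=(I_1,\dots,I_n)$ of complex intervals, regarded also as the set $I_1\times\dots\times I_n$; an interval matrix is a matrix $M$ of complex intervals, regarded also as the set of complex matrices $A$ with $A_{ij}\in M_{ij}$. Sums and products of interval matrices and vectors are formed with these operations. An interval extension of a complex-valued function over a set is any complex interval that contains its image on that set; for vector- or matrix-valued functions it is taken entrywise. The norm of an interval matrix $M$ is $$\|M\|=\max_{A\in M}\ \max_{v\neq 0}\ \frac{\|Av\|}{\|v\|},\qquad \|v\|=\max_{1\le i\le n}|v_i|.$$ **Theorem.** Let $H(x,t):\mathbb C^n\times[0,1]\to\mathbb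 C^n$, let $T\subset[0,1]$ be an interval, and suppose that $H(\cdot,t)$ is (complex) differentiable on $\mathbb C^n$ for every $t\in T$, with Jacobian matrix $\partial_xH(\cdot,t)$. Let $I\subset\mathbb C^n$ be an interval box, $x\in I$ a point, and $Y$ an invertible complex $n\times n$ matrix. Let $\square H(x,T)$ be any interval extension of $t\mapsto H(x,t)$ over $T$, and $\square\partial_xH(I,T)$ any interval extension of $(y,t)\mapsto\partial_xH(y,t)$ over $I\times T$. Define, in interval arithmetic, $$K_{x,Y}(I,T):=x-Y\cdot\square H(x,T)+\big(\mathbf 1_n-Y\cdot\square\partial_xH(I,T)\big)\cdot(I-x).$$ 1. If $K_{x,Y}(I,T)\subseteq I$, then for each $t\in T$ there is $y\in I$ with $H(y,t)=0$. 2. If in addition $\sqrt2\,\big\|\mathbf 1_n-Y\cdot\square\partial_xH(I,T)\big\|<1$, then for each $t\in T$ there is exactly one $y\in I$ with $H(y,t)=0$. -/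

import Mathlib

/-! ### Interval arithmetic over `ℝ`

A (closed, bounded, nonempty) real interval is Mathlib's `NonemptyInterval ℝ`, whose `+` and `-`
are the usual interval operations. Mathlib has no product of real intervals. -/

/-- The product `[a, b] · [c, d]` of two real intervals, given by the extreme products of
endpoints. By `mem_realIntervalMul` this is `{x * y | x ∈ [a, b], y ∈ [c, d]}`. -/
noncomputable def realIntervalMul (J K : NonemptyInterval ℝ) : NonemptyInterval ℝ where
  fst := min (min (J.fst * K.fst) (J.fst * K.snd)) (min (J.snd * K.fst) (J.snd * K.snd))
  snd := max (max (J.fst * K.fst) (J.fst * K.snd)) (max (J.snd * K.fst) (J.snd * K.snd))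
  fst_le_snd :=
    (min_le_left _ _).trans <| (min_le_left _ _).trans <|
      (le_max_left _ _).trans <| le_max_left _ _

theorem mem_realIntervalMul (J K : NonemptyInterval ℝ) (z : ℝ) :
    z ∈ realIntervalMul J K ↔ ∃ x ∈ J, ∃ y ∈ K, x * y = z := by
  have hJ := J.fst_le_snd
  have hK := K.fst_le_snd
  simp only [NonemptyInterval.mem_def, realIntervalMul]
  constructor
  · intro hz
    have hc : IsPreconnected ((fun p : ℝ × ℝ => p.1 * p.2) ''
        (Set.Icc J.fst J.snd ×ˢ Set.Icc K.fst K.snd)) :=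
      (isPreconnected_Icc.prod isPreconnected_Icc).image _ (by fun_prop)
    have key : ∀ a ∈ Set.Icc J.fst J.snd, ∀ b ∈ Set.Icc K.fst K.snd,
        a * b ∈ ((fun p : ℝ × ℝ => p.1 * p.2) ''
          (Set.Icc J.fst J.snd ×ˢ Set.Icc K.fst K.snd)) :=
      fun a ha b hb => ⟨(a, b), ⟨ha, hb⟩, rfl⟩
    have h1 := key _ (Set.left_mem_Icc.2 hJ) _ (Set.left_mem_Icc.2 hK)
    have h2 := key _ (Set.left_mem_Icc.2 hJ) _ (Set.right_mem_Icc.2 hK)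
    have h3 := key _ (Set.right_mem_Icc.2 hJ) _ (Set.left_mem_Icc.2 hK)
    have h4 := key _ (Set.right_mem_Icc.2 hJ) _ (Set.right_mem_Icc.2 hK)
    have hmin := min_rec' (· ∈ _) (min_rec' (· ∈ _) h1 h2) (min_rec' (· ∈ _) h3 h4)
    have hmax := max_rec' (· ∈ _) (max_rec' (· ∈ _) h1 h2) (max_rec' (· ∈ _) h3 h4)
    obtain ⟨⟨x, y⟩, ⟨hx, hy⟩, h⟩ := hc.Icc_subset hmin hmax hz
    exact ⟨x, hx, y, hy, h⟩
  · rintro ⟨x, ⟨hx1, hx2⟩, y, ⟨hy1, hy2⟩, rfl⟩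
    constructor
    · simp only [min_le_iff]
      by_contra! h
      obtain ⟨⟨h1, h2⟩, h3, h4⟩ := h
      rcases le_total 0 y with hy | hy <;> rcases le_total 0 J.fst with h0 | h0 <;>
        rcases le_total 0 J.snd with h0' | h0' <;> nlinarith
    · simp only [le_max_iff]
      by_contra! h
      obtain ⟨⟨h1, h2⟩, h3, h4⟩ := h
      rcases le_total 0 y with hy | hy <;> rcases le_total 0 J.fst with h0 | h0 <;>
        rcases le_total 0 J.snd with h0' | h0' <;> nlinarith

/-! ### Interval arithmetic over `ℂ` -/

/-- A complex interval `Re(J) + i Im(J)`, given by two real intervals. -/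
@[ext]
structure CInterval where
  re : NonemptyInterval ℝ
  im : NonemptyInterval ℝ

namespace CInterval

instance : Membership ℂ CInterval := ⟨fun J z => z.re ∈ J.re ∧ z.im ∈ J.im⟩

/-- A complex number, regarded as the degenerate interval `[Re z, Re z] + i [Im z, Im z]`. -/
def point (z : ℂ) : CInterval :=
  ⟨NonemptyInterval.pure z.re, NonemptyInterval.pure z.im⟩

instance : Zero CInterval := ⟨point 0⟩

instance : Add CInterval := ⟨fun J K => ⟨J.re + K.re, J.im + K.im⟩⟩

instance : Sub CInterval := ⟨fun J K => ⟨J.re - K.re, J.im - K.im⟩⟩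

noncomputable instance : Mul CInterval :=
  ⟨fun J K => ⟨realIntervalMul J.re K.re - realIntervalMul J.im K.im,
    realIntervalMul J.re K.im + realIntervalMul J.im K.re⟩⟩

/-- Interval addition is commutative and associative, so that finite sums make sense. -/
instance : AddCommMonoid CInterval where
  add_assoc J K L := CInterval.ext (add_assoc _ _ _) (add_assoc _ _ _)
  zero_add J := CInterval.ext (zero_add _) (zero_add _)
  add_zero J := CInterval.ext (add_zero _) (add_zero _)
  add_comm J K := CInterval.ext (add_comm _ _) (add_comm _ _)
  nsmul := nsmulRec

end CInterval

/-- `J` is an interval extension over `S` of the function `f`: it contains the image of `S`. -/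
def IsIntervalExtension {α : Type*} (f : α → ℂ) (S : Set α) (J : CInterval) : Prop :=
  ∀ a ∈ S, f a ∈ J

/-! ### Interval boxes and interval matrices

An `n`-dimensional interval box is a vector `Fin n → CInterval`, an interval matrix is a
`Matrix (Fin n) (Fin n) CInterval`; sums, differences and products of interval matrices are those
of Mathlib's `Matrix`, computed with the interval operations above on the entries. -/

/-- The subset of `ℂⁿ` described by an interval box. -/
def intervalBox {n : ℕ} (I : Fin n → CInterval) : Set (Fin n → ℂ) :=
  {x | ∀ i, x i ∈ I i}

/-- The set of complex matrices described by an interval matrix. -/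
def intervalMatrixSet {n : ℕ} (M : Matrix (Fin n) (Fin n) CInterval) :
    Set (Matrix (Fin n) (Fin n) ℂ) :=
  {A | ∀ i j, A i j ∈ M i j}

/-- The product of an interval matrix and an interval vector. -/
noncomputable def intervalMulVec {n : ℕ} (M : Matrix (Fin n) (Fin n) CInterval)
    (v : Fin n → CInterval) : Fin n → CInterval :=
  fun i => ∑ j, M i j * v j

/-- A vector regarded as a degenerate interval box. -/
def pointVec {n : ℕ} (x : Fin n → ℂ) : Fin n → CInterval :=
  fun i => CInterval.point (x i)

/-- A matrix regarded as a degenerate interval matrix. -/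
def pointMatrix {n : ℕ} (Y : Matrix (Fin n) (Fin n) ℂ) : Matrix (Fin n) (Fin n) CInterval :=
  Y.map CInterval.point

/-- The interval matrix norm: the largest operator norm, with respect to the max norm on `ℂⁿ`
(which is the norm of `Fin n → ℂ`), of a matrix in `M`. The set is bounded above, see
`bddAbove_intervalMatrixNorm`. -/
noncomputable def intervalMatrixNorm {n : ℕ} (M : Matrix (Fin n) (Fin n) CInterval) : ℝ :=
  sSup {r | ∃ A ∈ intervalMatrixSet M, ∃ x : Fin n → ℂ, x ≠ 0 ∧ r = ‖A.mulVec x‖ / ‖x‖}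

theorem bddAbove_intervalMatrixNorm {n : ℕ} (M : Matrix (Fin n) (Fin n) CInterval) :
    BddAbove {r | ∃ A ∈ intervalMatrixSet M, ∃ x : Fin n → ℂ,
      x ≠ 0 ∧ r = ‖A.mulVec x‖ / ‖x‖} := by
  have hb : ∀ i j, ∃ c : ℝ, 0 ≤ c ∧ ∀ z ∈ M i j, ‖z‖ ≤ c := by
    intro i j
    refine ⟨max |(M i j).re.fst| |(M i j).re.snd| + max |(M i j).im.fst| |(M i j).im.snd|,
      by positivity, fun z hz => ?_⟩
    obtain ⟨⟨h1, h2⟩, h3, h4⟩ := hz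
    exact (Complex.norm_le_abs_re_add_abs_im z).trans
      (add_le_add (abs_le_max_abs_abs h1 h2) (abs_le_max_abs_abs h3 h4))
  choose c hc0 hc using hb
  refine ⟨∑ i, ∑ j, c i j, ?_⟩
  rintro r ⟨A, hA, x, hx, rfl⟩
  rw [div_le_iff₀ (norm_pos_iff.2 hx)]
  have hs : ∀ i, 0 ≤ ∑ j, c i j := fun i => Finset.sum_nonneg fun j _ => hc0 i j
  refine (pi_norm_le_iff_of_nonneg
    (mul_nonneg (Finset.sum_nonneg fun i _ => hs i) (norm_nonneg _))).2 fun i => ?_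
  calc ‖A.mulVec x i‖ = ‖∑ j, A i j * x j‖ := rfl
    _ ≤ ∑ j, ‖A i j * x j‖ := norm_sum_le _ _
    _ ≤ ∑ j, c i j * ‖x‖ := Finset.sum_le_sum fun j _ => by
        rw [norm_mul]
        exact mul_le_mul (hc i j _ (hA i j)) (norm_le_pi_norm x j) (norm_nonneg _) (hc0 i j)
    _ = (∑ j, c i j) * ‖x‖ := (Finset.sum_mul _ _ _).symm
    _ ≤ _ := mul_le_mul_of_nonneg_right
        (Finset.single_le_sum (fun i _ => hs i) (Finset.mem_univ i)) (norm_nonneg _)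

/-! ### The parametric Krawczyk operator -/

/-- The Jacobian matrix `∂ₓH(x, t)` of `H` with respect to the `x` variables. -/
noncomputable def jacobianX {n : ℕ} (H : (Fin n → ℂ) → unitInterval → (Fin n → ℂ))
    (x : Fin n → ℂ) (t : unitInterval) : Matrix (Fin n) (Fin n) ℂ :=
  Matrix.of fun i j => fderiv ℂ (fun y => H y t) x (Pi.single j 1) i

/-- The interval matrix `1 - Y · D`. -/
noncomputable def krawczykMatrix {n : ℕ} (Y : Matrix (Fin n) (Fin n) ℂ)
    (D : Matrix (Fin n) (Fin n) CInterval) : Matrix (Fin n) (Fin n) CInterval :=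
  pointMatrix 1 - pointMatrix Y * D

/-- The Krawczyk operator `x - Y · h + (1 - Y · D) · (I - x)`, evaluated in interval arithmetic.
For the parametric operator, `h` is an interval extension `□H(x, T)` and `D` is an interval
extension `□∂ₓH(I, T)`. -/
noncomputable def krawczykOperator {n : ℕ} (x : Fin n → ℂ) (Y : Matrix (Fin n) (Fin n) ℂ)
    (h : Fin n → CInterval) (D : Matrix (Fin n) (Fin n) CInterval)
    (I : Fin n → CInterval) : Fin n → CInterval :=
  pointVec x - intervalMulVec (pointMatrix Y) h
    + intervalMulVec (krawczykMatrix Y D) (I - pointVec x)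

open Set

/-! Fix `t` and put `G = H(·, t)`. As `Y` is invertible, the zeros of `G` are the fixed points of
`N(y) = y - Y · G(y)`, whose derivative at `w ∈ I` is `1 - Y · G'(w)`, a member of `1 - Y · D`. The
mean value theorem, applied to one real coordinate at a time, places `N(y)` in the Krawczyk
interval, so `N` maps `I` into itself (`newtonMap_mapsTo`).

Brouwer's theorem is not needed. The inclusion `K ⊆ I` forces every member of `1 - Y · D` to be
nonexpansive relative to the side lengths of `I` (`mulVec_le_of_krawczykOperator_subset`). Hence so
is `N`, and a nonexpansive self-map of a compact convex set has a fixed point, by approximation with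
contractions (`exists_fixedPoint_of_nonexpansive`). Uniqueness is the mean value inequality with a
constant below 1. -/

/-! ### Fixed points of nonexpansive maps -/

/-- A nonexpansive self-map of a nonempty compact convex set has a fixed point. -/
theorem exists_fixedPoint_of_nonexpansive {E : Type*} [NormedAddCommGroup E] [NormedSpace ℝ E]
    {s : Set E} (hs : IsCompact s) (hconv : Convex ℝ s) (hne : s.Nonempty) {f : E → E}
    (hmaps : MapsTo f s s) (hf : LipschitzOnWith 1 f s) : ∃ y ∈ s, f y = y := by
  obtain ⟨x₀, hx₀⟩ := hne
  have hlip : ∀ y ∈ s, ∀ z ∈ s, ‖f y - f z‖ ≤ ‖y - z‖ := fun y hy z hz => by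
    simpa using hf.norm_sub_le hy hz
  -- By compactness the displacement attains its minimum. If that minimum were positive, the fixed
  -- point of a nearby contraction would have smaller displacement.
  obtain ⟨y₀, hy₀, hmin⟩ := hs.exists_isMinOn ⟨x₀, hx₀⟩
    (f := fun y => ‖f y - y‖) ((hf.continuousOn.sub continuousOn_id).norm)
  refine ⟨y₀, hy₀, ?_⟩
  by_contra hne
  have hd : 0 < ‖f y₀ - y₀‖ := norm_pos_iff.2 (sub_ne_zero.2 hne)
  obtain ⟨C, hC⟩ := hs.isBounded.exists_norm_le
  have hC0 : 0 ≤ C := (norm_nonneg _).trans (hC x₀ hx₀)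
  obtain ⟨ε, hε0, hε1, hεd⟩ : ∃ ε : ℝ, 0 < ε ∧ ε < 1 ∧ ε * (2 * C) < ‖f y₀ - y₀‖ := by
    set d := ‖f y₀ - y₀‖
    refine ⟨d / (2 * C + d + 1), by positivity, ?_, ?_⟩
    · rw [div_lt_one (by positivity)]; linarith
    · rw [div_mul_eq_mul_div, div_lt_iff₀ (by positivity)]
      nlinarith
  -- Pulling `f` slightly towards `x₀` gives a `(1 - ε)`-contraction of `s`; its Banach fixed point
  -- is moved by `f` by at most `2Cε`.
  set g : E → E := fun y => ε • x₀ + (1 - ε) • f y with hg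
  have hgmaps : MapsTo g s s := fun y hy =>
    hconv hx₀ (hmaps hy) hε0.le (by linarith) (by ring)
  have hgc : ContractingWith (1 - ε).toNNReal (hgmaps.restrict g s s) := by
    refine ⟨by rw [← NNReal.coe_lt_coe, Real.coe_toNNReal _ (by linarith)]; simpa using hε0, ?_⟩
    refine LipschitzWith.of_dist_le_mul fun y z => ?_
    rw [Real.coe_toNNReal _ (by linarith), Subtype.dist_eq, Subtype.dist_eq, dist_eq_norm,
      dist_eq_norm]
    have : g y - g z = (1 - ε) • (f y - f z) := by simp only [hg]; module
    rw [MapsTo.val_restrict_apply, MapsTo.val_restrict_apply, this, norm_smul,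
      Real.norm_of_nonneg (by linarith)]
    exact mul_le_mul_of_nonneg_left (hlip _ y.2 _ z.2) (by linarith)
  obtain ⟨y, hy, hfix, -⟩ := hgc.exists_fixedPoint' hs.isComplete hgmaps hx₀ (edist_ne_top _ _)
  have h1 : f y - y = ε • (f y - x₀) := by
    have : y = ε • x₀ + (1 - ε) • f y := hfix.symm
    nth_rewrite 2 [this]
    module
  have h2 : ‖f y - y‖ ≤ ε * (2 * C) := by
    rw [h1, norm_smul, Real.norm_of_nonneg hε0.le]
    refine mul_le_mul_of_nonneg_left ((norm_sub_le _ _).trans ?_) hε0.le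
    linarith [hC _ (hmaps hy), hC _ hx₀]
  have h3 : ‖f y₀ - y₀‖ ≤ ‖f y - y‖ := hmin hy
  linarith

/-- A self-map of a box in `ℝ^ι` that is nonexpansive relative to the side lengths of the box has a
fixed point. Sides of length zero are allowed. -/
theorem exists_fixedPoint_Icc {ι : Type*} [Fintype ι] {a b : ι → ℝ} (hab : a ≤ b)
    {f : (ι → ℝ) → ι → ℝ} (hmaps : MapsTo f (Icc a b) (Icc a b))
    (hf : ∀ y ∈ Icc a b, ∀ z ∈ Icc a b, ∀ c > 0, (∀ l, |y l - z l| ≤ c * (b l - a l)) →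
      ∀ k, |f y k - f z k| ≤ c * (b k - a k)) :
    ∃ y ∈ Icc a b, f y = y := by
  -- Rescaling to the unit cube turns the relative condition into nonexpansiveness in the sup norm.
  set g : (ι → ℝ) → ι → ℝ := fun u k => a k + (b k - a k) * u k with hg
  have hgm : ∀ u ∈ Icc (0 : ι → ℝ) 1, g u ∈ Icc a b := fun u hu => by
    refine ⟨fun k => ?_, fun k => ?_⟩ <;>
    · have h0 := hu.1 k
      have h1 := hu.2 k
      have h2 := hab k
      simp only [Pi.zero_apply, Pi.one_apply, hg] at h0 h1 ⊢
      nlinarith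
  -- On a side of length zero the quotient is `0` by convention, which still lies in `[0, 1]`.
  set F : (ι → ℝ) → ι → ℝ := fun u k => (f (g u) k - a k) / (b k - a k) with hF
  have hFm : MapsTo F (Icc 0 1) (Icc 0 1) := fun u hu => by
    have h := hmaps (hgm u hu)
    refine ⟨fun k => ?_, fun k => ?_⟩
    · exact div_nonneg (sub_nonneg.2 (h.1 k)) (sub_nonneg.2 (hab k))
    · exact div_le_one_of_le₀ (sub_le_sub_right (h.2 k) _) (sub_nonneg.2 (hab k))
  have hFl : LipschitzOnWith 1 F (Icc 0 1) := by
    refine LipschitzOnWith.of_dist_le_mul fun u hu v hv => ?_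
    rw [NNReal.coe_one, one_mul]
    rcases eq_or_ne u v with rfl | huv
    · simp
    refine (dist_pi_le_iff dist_nonneg).2 fun k => ?_
    have h := hf _ (hgm u hu) _ (hgm v hv) (dist u v) (dist_pos.2 huv) (fun l => by
      have h1 : g u l - g v l = (u l - v l) * (b l - a l) := by simp only [hg]; ring
      have h2 : 0 ≤ b l - a l := sub_nonneg.2 (hab l)
      rw [h1, abs_mul, abs_of_nonneg h2, ← Real.dist_eq]
      exact mul_le_mul_of_nonneg_right (dist_le_pi_dist u v l) h2) k
    have h2 : 0 ≤ b k - a k := sub_nonneg.2 (hab k)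
    have h3 : F u k - F v k = (f (g u) k - f (g v) k) / (b k - a k) := by
      simp only [hF]; ring
    rw [Real.dist_eq, h3, abs_div, abs_of_nonneg h2]
    exact div_le_of_le_mul₀ h2 dist_nonneg h
  obtain ⟨u, hu, hFu⟩ := exists_fixedPoint_of_nonexpansive isCompact_Icc (convex_Icc _ _)
    ⟨0, left_mem_Icc.2 zero_le_one⟩ hFm hFl
  refine ⟨g u, hgm u hu, funext fun k => ?_⟩
  have h := hmaps (hgm u hu)
  have h1 : F u k = u k := congrFun hFu k
  -- On a degenerate side `F` carries no information, but the box leaves only one possible value.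
  rcases (sub_nonneg.2 (hab k)).eq_or_lt with h0 | h0
  · have h2 := h.1 k
    have h3 := h.2 k
    have : g u k = a k := by simp [hg, ← h0]
    linarith
  · change f (g u) k = a k + (b k - a k) * u k
    rw [← h1]
    simp only [hF]
    field_simp
    ring

/-! ### Containment properties of interval arithmetic -/

namespace CInterval

theorem mem_point (z : ℂ) : z ∈ point z :=
  ⟨⟨le_rfl, le_rfl⟩, le_rfl, le_rfl⟩

theorem add_mem_add {J K : CInterval} {z w : ℂ} (hz : z ∈ J) (hw : w ∈ K) : z + w ∈ J + K :=
  ⟨⟨add_le_add hz.1.1 hw.1.1, add_le_add hz.1.2 hw.1.2⟩,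
    add_le_add hz.2.1 hw.2.1, add_le_add hz.2.2 hw.2.2⟩

theorem sub_mem_sub {J K : CInterval} {z w : ℂ} (hz : z ∈ J) (hw : w ∈ K) : z - w ∈ J - K :=
  ⟨⟨sub_le_sub hz.1.1 hw.1.2, sub_le_sub hz.1.2 hw.1.1⟩,
    sub_le_sub hz.2.1 hw.2.2, sub_le_sub hz.2.2 hw.2.1⟩

theorem mul_mem_mul {J K : CInterval} {z w : ℂ} (hz : z ∈ J) (hw : w ∈ K) : z * w ∈ J * K := by
  have h {A B : NonemptyInterval ℝ} {s t : ℝ} (hs : s ∈ A) (ht : t ∈ B) :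
      s * t ∈ realIntervalMul A B := (mem_realIntervalMul _ _ _).2 ⟨s, hs, t, ht, rfl⟩
  have h1 := h hz.1 hw.1
  have h2 := h hz.2 hw.2
  have h3 := h hz.1 hw.2
  have h4 := h hz.2 hw.1
  exact ⟨⟨sub_le_sub h1.1 h2.2, sub_le_sub h1.2 h2.1⟩,
    add_le_add h3.1 h4.1, add_le_add h3.2 h4.2⟩

theorem sum_mem_sum {ι : Type*} (s : Finset ι) {z : ι → ℂ} {J : ι → CInterval}
    (h : ∀ i ∈ s, z i ∈ J i) : ∑ i ∈ s, z i ∈ ∑ i ∈ s, J i := by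
  classical
  induction s using Finset.induction_on with
  | empty => exact mem_point 0
  | insert i s hi ih =>
    rw [Finset.sum_insert hi, Finset.sum_insert hi]
    exact add_mem_add (h i (Finset.mem_insert_self _ _))
      (ih fun j hj => h j (Finset.mem_insert_of_mem hj))

theorem midpoint_add_mem {J : CInterval} {d : ℂ} (hre : |d.re| ≤ (J.re.snd - J.re.fst) / 2)
    (him : |d.im| ≤ (J.im.snd - J.im.fst) / 2) :
    (⟨(J.re.fst + J.re.snd) / 2, (J.im.fst + J.im.snd) / 2⟩ : ℂ) + d ∈ J := by
  rw [abs_le] at hre him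
  refine ⟨⟨?_, ?_⟩, ?_, ?_⟩ <;> simp only [Complex.add_re, Complex.add_im] <;> linarith

end CInterval

section Box

variable {n : ℕ}

theorem mulVec_mem_intervalMulVec {M : Matrix (Fin n) (Fin n) CInterval}
    {A : Matrix (Fin n) (Fin n) ℂ}
    (hA : A ∈ intervalMatrixSet M) {J : Fin n → CInterval} {v : Fin n → ℂ}
    (hv : v ∈ intervalBox J) : A.mulVec v ∈ intervalBox (intervalMulVec M J) :=
  fun i => CInterval.sum_mem_sum _ fun j _ => CInterval.mul_mem_mul (hA i j) (hv j)

theorem pointMatrix_mem (Y : Matrix (Fin n) (Fin n) ℂ) : Y ∈ intervalMatrixSet (pointMatrix Y) :=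
  fun i j => CInterval.mem_point (Y i j)

theorem krawczykMatrix_mem (Y : Matrix (Fin n) (Fin n) ℂ) {D : Matrix (Fin n) (Fin n) CInterval}
    {A : Matrix (Fin n) (Fin n) ℂ} (hA : A ∈ intervalMatrixSet D) :
    1 - Y * A ∈ intervalMatrixSet (krawczykMatrix Y D) := fun i j =>
  CInterval.sub_mem_sub (pointMatrix_mem 1 i j) <| CInterval.sum_mem_sum _ fun k _ =>
    CInterval.mul_mem_mul (pointMatrix_mem Y i k) (hA k j)

/-- The only route by which the hypothesis `K ⊆ I` is exploited: `w`, `A` and `p` may be chosen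
independently. -/
theorem krawczykOperator_mem (x : Fin n → ℂ) (Y : Matrix (Fin n) (Fin n) ℂ)
    {J I : Fin n → CInterval} {D : Matrix (Fin n) (Fin n) CInterval} {w p : Fin n → ℂ}
    {A : Matrix (Fin n) (Fin n) ℂ} (hw : w ∈ intervalBox J) (hA : A ∈ intervalMatrixSet D)
    (hp : p ∈ intervalBox I) :
    x - Y.mulVec w + (1 - Y * A).mulVec (p - x) ∈ intervalBox (krawczykOperator x Y J D I) :=
  fun i => CInterval.add_mem_add
    (CInterval.sub_mem_sub (CInterval.mem_point _)
      (mulVec_mem_intervalMulVec (pointMatrix_mem Y) hw i))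
    (mulVec_mem_intervalMulVec (krawczykMatrix_mem Y hA)
      (fun j => CInterval.sub_mem_sub (hp j) (CInterval.mem_point (x j))) i)

theorem convex_intervalBox (I : Fin n → CInterval) : Convex ℝ (intervalBox I) := by
  intro y hy z hz a b ha hb hab i
  have h1 := convex_Icc (𝕜 := ℝ) _ _ (hy i).1 (hz i).1 ha hb hab
  have h2 := convex_Icc (𝕜 := ℝ) _ _ (hy i).2 (hz i).2 ha hb hab
  refine ⟨?_, ?_⟩
  · simpa [NonemptyInterval.mem_def] using h1
  · simpa [NonemptyInterval.mem_def] using h2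

theorem norm_mulVec_le_intervalMatrixNorm {M : Matrix (Fin n) (Fin n) CInterval}
    {A : Matrix (Fin n) (Fin n) ℂ} (hA : A ∈ intervalMatrixSet M) (v : Fin n → ℂ) :
    ‖A.mulVec v‖ ≤ intervalMatrixNorm M * ‖v‖ := by
  rcases eq_or_ne v 0 with rfl | hv
  · simp
  · exact (div_le_iff₀ (norm_pos_iff.2 hv)).1
      (le_csSup (bddAbove_intervalMatrixNorm M) ⟨A, hA, v, hv, rfl⟩)

theorem intervalMatrixNorm_nonneg (M : Matrix (Fin n) (Fin n) CInterval) :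
    0 ≤ intervalMatrixNorm M :=
  Real.sSup_nonneg <| by
    rintro r ⟨A, -, v, -, rfl⟩
    positivity

/-- A self-map of a complex interval box whose real and imaginary coordinates are nonexpansive
relative to the side lengths of the box has a fixed point. -/
theorem exists_fixedPoint_intervalBox {I : Fin n → CInterval} {f : (Fin n → ℂ) → Fin n → ℂ}
    (hmaps : MapsTo f (intervalBox I) (intervalBox I))
    (hf : ∀ y ∈ intervalBox I, ∀ z ∈ intervalBox I, ∀ c > 0,
      (∀ j, |(y j - z j).re| ≤ c * ((I j).re.snd - (I j).re.fst) ∧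
        |(y j - z j).im| ≤ c * ((I j).im.snd - (I j).im.fst)) →
      ∀ i, |(f y i - f z i).re| ≤ c * ((I i).re.snd - (I i).re.fst) ∧
        |(f y i - f z i).im| ≤ c * ((I i).im.snd - (I i).im.fst)) :
    ∃ y ∈ intervalBox I, f y = y := by
  -- The complex box is a real box in the `2n` real and imaginary coordinates.
  let dec : (Fin n ⊕ Fin n → ℝ) → Fin n → ℂ := fun u i => ⟨u (.inl i), u (.inr i)⟩
  let enc : (Fin n → ℂ) → Fin n ⊕ Fin n → ℝ := fun y =>
    Sum.elim (fun i => (y i).re) fun i => (y i).im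
  let a : Fin n ⊕ Fin n → ℝ := Sum.elim (fun i => (I i).re.fst) fun i => (I i).im.fst
  let b : Fin n ⊕ Fin n → ℝ := Sum.elim (fun i => (I i).re.snd) fun i => (I i).im.snd
  have hab : a ≤ b := by
    rintro (i | i)
    exacts [(I i).re.fst_le_snd, (I i).im.fst_le_snd]
  have hdec : ∀ u ∈ Icc a b, dec u ∈ intervalBox I := fun u hu i =>
    ⟨⟨hu.1 (.inl i), hu.2 (.inl i)⟩, hu.1 (.inr i), hu.2 (.inr i)⟩
  have henc : ∀ y ∈ intervalBox I, enc y ∈ Icc a b := fun y hy => by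
    constructor <;> rintro (i | i)
    exacts [(hy i).1.1, (hy i).2.1, (hy i).1.2, (hy i).2.2]
  obtain ⟨u, hu, hfix⟩ := exists_fixedPoint_Icc hab (f := fun u => enc (f (dec u)))
    (fun u hu => henc _ (hmaps (hdec u hu))) (fun u hu v hv c hc h => by
      have := hf _ (hdec u hu) _ (hdec v hv) c hc fun j => ⟨h (.inl j), h (.inr j)⟩
      rintro (i | i)
      exacts [(this i).1, (this i).2])
  refine ⟨dec u, hdec u hu, funext fun i => Complex.ext ?_ ?_⟩
  exacts [congrFun hfix (.inl i), congrFun hfix (.inr i)]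

end Box

/-! ### The Krawczyk test for a single map -/

section Krawczyk

variable {n : ℕ} {G : (Fin n → ℂ) → Fin n → ℂ} {I : Fin n → CInterval} {x : Fin n → ℂ}
  {Y : Matrix (Fin n) (Fin n) ℂ} {h : Fin n → CInterval} {D : Matrix (Fin n) (Fin n) CInterval}

/-- The Jacobian matrix of `G` at `y`. -/
noncomputable def jacobian (G : (Fin n → ℂ) → Fin n → ℂ) (y : Fin n → ℂ) :
    Matrix (Fin n) (Fin n) ℂ :=
  Matrix.of fun i j => fderiv ℂ G y (Pi.single j 1) i

/-- The Newton-type map `y ↦ y - Y · G(y)`, whose fixed points are the zeros of `G`. -/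
noncomputable def newtonMap (Y : Matrix (Fin n) (Fin n) ℂ) (G : (Fin n → ℂ) → Fin n → ℂ)
    (y : Fin n → ℂ) : Fin n → ℂ :=
  y - Y.mulVec (G y)

theorem newtonMap_eq_self_iff (hY : IsUnit Y) {y : Fin n → ℂ} : newtonMap Y G y = y ↔ G y = 0 := by
  rw [newtonMap, sub_eq_self]
  exact ⟨fun h0 => Matrix.mulVec_injective_of_isUnit hY (by simpa using h0), fun h0 => by simp [h0]⟩

theorem jacobian_mulVec (y v : Fin n → ℂ) : (jacobian G y).mulVec v = fderiv ℂ G y v := by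
  have hv : v = ∑ j, v j • (Pi.single j 1 : Fin n → ℂ) := by
    simpa using pi_eq_sum_univ' v
  nth_rewrite 2 [hv]
  ext i
  simp [jacobian, Matrix.mulVec, dotProduct, mul_comm]

theorem hasFDerivAt_newtonMap (hG : Differentiable ℂ G) (y : Fin n → ℂ) :
    HasFDerivAt (newtonMap Y G)
      (LinearMap.toContinuousLinearMap (1 - Y * jacobian G y).mulVecLin) y := by
  have h1 := (LinearMap.toContinuousLinearMap Y.mulVecLin).hasFDerivAt.comp y (hG y).hasFDerivAt
  refine ((hasFDerivAt_id y).sub h1).congr_fderiv ?_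
  ext1 v
  simp [jacobian_mulVec]

/-- The mean value theorem for real functionals of the Newton-type map on an interval box. -/
theorem exists_newtonMap_sub_eq (hG : Differentiable ℂ G) (L : (Fin n → ℂ) →L[ℝ] ℝ)
    {y z : Fin n → ℂ} (hy : y ∈ intervalBox I) (hz : z ∈ intervalBox I) :
    ∃ w ∈ intervalBox I, L (newtonMap Y G y - newtonMap Y G z) =
      L ((1 - Y * jacobian G w).mulVec (y - z)) := by
  -- The mean value equality requires a real-valued function, so the intermediate point `w` depends
  -- on `L`.
  obtain ⟨w, hw, h⟩ := domain_mvt (f := fun y => L (newtonMap Y G y)) (s := intervalBox I)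
    (fun u _ => (L.hasFDerivAt.comp u
      ((hasFDerivAt_newtonMap (Y := Y) hG u).restrictScalars ℝ)).hasFDerivWithinAt)
    (convex_intervalBox I) hz hy
  refine ⟨w, (convex_intervalBox I).segment_subset hz hy hw, ?_⟩
  rw [map_sub]
  exact h

theorem newtonMap_mapsTo (hG : Differentiable ℂ G) (hx : x ∈ intervalBox I)
    (hh : G x ∈ intervalBox h) (hD : ∀ y ∈ intervalBox I, jacobian G y ∈ intervalMatrixSet D)
    (hK : intervalBox (krawczykOperator x Y h D I) ⊆ intervalBox I) :
    MapsTo (newtonMap Y G) (intervalBox I) (intervalBox I) := by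
  intro y hy i
  -- Real and imaginary parts may need different intermediate points. This is harmless, since `I i`
  -- is a rectangle and its two sides can be tested separately.
  have key : ∀ l : ℂ →L[ℝ] ℝ, ∃ v ∈ I i, l (newtonMap Y G y i) = l v := fun l => by
    obtain ⟨w, hw, hmv⟩ := exists_newtonMap_sub_eq (Y := Y) hG
      (l.comp (ContinuousLinearMap.proj (R := ℝ) (φ := fun _ : Fin n => ℂ) i)) hy hx
    refine ⟨_, hK (krawczykOperator_mem x Y hh (hD w hw) hy) i, ?_⟩
    simp only [ContinuousLinearMap.comp_apply, ContinuousLinearMap.proj_apply, map_sub] at hmv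
    rw [Pi.add_apply, map_add, ← hmv]
    simp [newtonMap]
  obtain ⟨v, hv, hvr⟩ := key Complex.reCLM
  obtain ⟨w, hw, hwi⟩ := key Complex.imCLM
  simp only [Complex.reCLM_apply, Complex.imCLM_apply] at hvr hwi
  exact ⟨hvr ▸ hv.1, hwi ▸ hw.2⟩

/-- If the Krawczyk operator maps the box into itself, then every matrix in `1 - Y · D` is
nonexpansive relative to the side lengths of the box. -/
theorem mulVec_le_of_krawczykOperator_subset {A : Matrix (Fin n) (Fin n) ℂ} {w d : Fin n → ℂ}
    (hw : w ∈ intervalBox h) (hA : A ∈ intervalMatrixSet D)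
    (hK : intervalBox (krawczykOperator x Y h D I) ⊆ intervalBox I) {c : ℝ} (hc : 0 < c)
    (hd : ∀ j, |(d j).re| ≤ c * ((I j).re.snd - (I j).re.fst) ∧
      |(d j).im| ≤ c * ((I j).im.snd - (I j).im.fst)) (i : Fin n) :
    |((1 - Y * A).mulVec d i).re| ≤ c * ((I i).re.snd - (I i).re.fst) ∧
      |((1 - Y * A).mulVec d i).im| ≤ c * ((I i).im.snd - (I i).im.fst) := by
  set m : Fin n → ℂ := fun j =>
    ⟨((I j).re.fst + (I j).re.snd) / 2, ((I j).im.fst + (I j).im.snd) / 2⟩ with hm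
  -- The factor `1 / (2c)` scales `d` to at most half of each side, so both `m ± d / (2c)` stay in
  -- the box.
  have hmem : ∀ r : ℝ, |r| = (2 * c)⁻¹ → m + r • d ∈ intervalBox I := fun r hr j => by
    have hb : ∀ s t : ℝ, |s| ≤ c * t → |r * s| ≤ t / 2 := fun s t hst => by
      rw [abs_mul, hr, inv_mul_le_iff₀ (by positivity)]
      linarith
    refine CInterval.midpoint_add_mem ?_ ?_
    · simpa using hb _ _ (hd j).1
    · simpa using hb _ _ (hd j).2
  have habs : |(2 * c)⁻¹| = (2 * c)⁻¹ := abs_of_pos (by positivity)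
  have hp := hK (krawczykOperator_mem x Y hw hA (hmem (2 * c)⁻¹ habs)) i
  have hq := hK (krawczykOperator_mem x Y hw hA (hmem (-(2 * c)⁻¹) (by rw [abs_neg, habs]))) i
  set B := 1 - Y * A
  -- The affine terms cancel in the difference of the two images, leaving `B d / c`. Both images lie
  -- in `I`, so their coordinates differ by at most the side lengths.
  have hsub : B.mulVec d i = (c : ℂ) *
      ((x - Y.mulVec w + B.mulVec (m + (2 * c)⁻¹ • d - x)) i -
        (x - Y.mulVec w + B.mulVec (m + (-(2 * c)⁻¹) • d - x)) i) := by
    have hcc : (c : ℂ) ≠ 0 := by exact_mod_cast hc.ne'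
    simp only [Matrix.mulVec_add, Matrix.mulVec_sub, Matrix.mulVec_smul, Pi.add_apply,
      Pi.sub_apply, Pi.smul_apply, Complex.real_smul]
    push_cast
    field_simp
    ring
  rw [hsub, Complex.re_ofReal_mul, Complex.im_ofReal_mul, abs_mul, abs_mul, abs_of_pos hc,
    Complex.sub_re, Complex.sub_im]
  obtain ⟨⟨h1, h2⟩, h3, h4⟩ := hp
  obtain ⟨⟨h5, h6⟩, h7, h8⟩ := hq
  constructor <;> refine mul_le_mul_of_nonneg_left (abs_le.2 ⟨?_, ?_⟩) hc.le <;> linarith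

theorem exists_zero_of_krawczykOperator_subset (hG : Differentiable ℂ G) (hx : x ∈ intervalBox I)
    (hY : IsUnit Y) (hh : G x ∈ intervalBox h)
    (hD : ∀ y ∈ intervalBox I, jacobian G y ∈ intervalMatrixSet D)
    (hK : intervalBox (krawczykOperator x Y h D I) ⊆ intervalBox I) :
    ∃ y ∈ intervalBox I, G y = 0 := by
  obtain ⟨y, hy, hfix⟩ := exists_fixedPoint_intervalBox (newtonMap_mapsTo hG hx hh hD hK)
    (fun y hy z hz c hc hyz i => by
      have key : ∀ l : ℂ →L[ℝ] ℝ, ∃ w ∈ intervalBox I,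
          l (newtonMap Y G y i - newtonMap Y G z i) =
            l ((1 - Y * jacobian G w).mulVec (y - z) i) := fun l =>
        exists_newtonMap_sub_eq (Y := Y) hG
          (l.comp (ContinuousLinearMap.proj (R := ℝ) (φ := fun _ : Fin n => ℂ) i)) hy hz
      -- The intermediate points `v` and `w` may differ, but the bound holds for every matrix in `1
      -- - Y · D`.
      obtain ⟨v, hv, hvr⟩ := key Complex.reCLM
      obtain ⟨w, hw, hwi⟩ := key Complex.imCLM
      simp only [Complex.reCLM_apply, Complex.imCLM_apply] at hvr hwi
      rw [hvr, hwi]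
      exact ⟨(mulVec_le_of_krawczykOperator_subset hh (hD v hv) hK hc hyz i).1,
        (mulVec_le_of_krawczykOperator_subset hh (hD w hw) hK hc hyz i).2⟩)
  exact ⟨y, hy, (newtonMap_eq_self_iff hY).1 hfix⟩

/-- The norm bounds the derivative of the Newton-type map on the convex box, making it a strict
contraction there; two zeros would be two fixed points. -/
theorem zero_unique_of_intervalMatrixNorm_lt_one (hG : Differentiable ℂ G) (hY : IsUnit Y)
    (hD : ∀ y ∈ intervalBox I, jacobian G y ∈ intervalMatrixSet D)
    (hM : intervalMatrixNorm (krawczykMatrix Y D) < 1) {y z : Fin n → ℂ}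
    (hy : y ∈ intervalBox I) (hz : z ∈ intervalBox I) (hGy : G y = 0) (hGz : G z = 0) : y = z := by
  have hle := (convex_intervalBox I).norm_image_sub_le_of_norm_hasFDerivWithin_le (𝕜 := ℂ)
    (f := newtonMap Y G) (C := intervalMatrixNorm (krawczykMatrix Y D))
    (fun u _ => (hasFDerivAt_newtonMap hG u).hasFDerivWithinAt)
    (fun u hu => ContinuousLinearMap.opNorm_le_bound _ (intervalMatrixNorm_nonneg _) fun v =>
      norm_mulVec_le_intervalMatrixNorm (krawczykMatrix_mem Y (hD u hu)) v) hz hy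
  rw [(newtonMap_eq_self_iff hY).2 hGy, (newtonMap_eq_self_iff hY).2 hGz] at hle
  by_contra hne
  have : 0 < ‖y - z‖ := norm_pos_iff.2 (sub_ne_zero.2 hne)
  nlinarith

end Krawczyk

/-- Parametric Krawczyk test: existence, and uniqueness under the norm condition, of a solution of
`H(·, t) = 0` in the box `I` for every `t ∈ T`. -/
theorem theorem3p1 (n : ℕ) (H : (Fin n → ℂ) → unitInterval → (Fin n → ℂ))
    (T : Set unitInterval) (hT : T.OrdConnected)
    (hH : ∀ t ∈ T, Differentiable ℂ (fun y => H y t))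
    (I : Fin n → CInterval) (x : Fin n → ℂ) (hx : x ∈ intervalBox I)
    (Y : Matrix (Fin n) (Fin n) ℂ) (hY : IsUnit Y)
    (boxH : Fin n → CInterval)
    (hboxH : ∀ i, IsIntervalExtension (fun t => H x t i) T (boxH i))
    (boxDH : Matrix (Fin n) (Fin n) CInterval)
    (hboxDH : ∀ i j, IsIntervalExtension
      (fun p : (Fin n → ℂ) × unitInterval => jacobianX H p.1 p.2 i j)
      (intervalBox I ×ˢ T) (boxDH i j))
    (hK : intervalBox (krawczykOperator x Y boxH boxDH I) ⊆ intervalBox I) :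
    (∀ t ∈ T, ∃ y ∈ intervalBox I, H y t = 0) ∧
    (Real.sqrt 2 * intervalMatrixNorm (krawczykMatrix Y boxDH) < 1 →
      ∀ t ∈ T, ∃! y, y ∈ intervalBox I ∧ H y t = 0) := by
  have hD : ∀ t ∈ T, ∀ y ∈ intervalBox I,
      jacobian (fun y => H y t) y ∈ intervalMatrixSet boxDH :=
    fun t ht y hy i j => hboxDH i j (y, t) ⟨hy, ht⟩
  have hex : ∀ t ∈ T, ∃ y ∈ intervalBox I, H y t = 0 := fun t ht =>
    exists_zero_of_krawczykOperator_subset (hH t ht) hx hY (fun i => hboxH i t ht) (hD t ht) hK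
  refine ⟨hex, fun hM t ht => ?_⟩
  obtain ⟨y, hy, hHy⟩ := hex t ht
  -- The mean value inequality in the complex max norm needs only the bound without `√2`, which
  -- follows from `1 ≤ √2`.
  have hlt : intervalMatrixNorm (krawczykMatrix Y boxDH) < 1 :=
    (le_mul_of_one_le_left (intervalMatrixNorm_nonneg _)
      (Real.one_le_sqrt.2 one_le_two)).trans_lt hM
  exact ⟨y, ⟨hy, hHy⟩, fun z hz =>
    zero_unique_of_intervalMatrixNorm_lt_one (hH t ht) hY (hD t ht) hlt hz.1 hy hz.2 hHy⟩
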